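/- Let $q$ be a prime power and let $r>h\ge 1$ be integers. Write $[i]_q=\frac{q^i-1}{q-1}$ and $g_q(k,d)=\sum_{i=0}^{k-1}\lceil d/q^i\rceil$. A projective $h$-$(n,r,s)_q$ system is a multiset of $n$ subspaces of $\mathbb{F}_q^r$, each of vector space dimension at most $h$, such that every hyperplane (i.e. every $(r-1)$-dimensional subspace) contains at most $s$ of them, counted with multiplicity, and some hyperplane contains exactly $s$ of them. Let $n_q(r,h;s)$ denote the maximum $n$ for which a projective $h$-$(n,r,s)_q$ system exists. The Griesmer upper bound for $n_q(r,h;s)$ is the largest integer $n$ with $g_q\left(r,q^{h-1}(n-s)\right)\le [h]_q\cdot n$. Then, for all sufficiently large $s$ (depending only on $q$, $r$ and $h$), the maximum $n_q(r,h;s)$ exists and is equal to the Griesmer upper bound for $n_q(r,h;s)$. In terms of codes: let an additive $[n,r/h,d]_q^h$ code be an $\mathbb{F}_q$-linear subspace of $\mathbb{F}_{q^h}^n$ of $\mathbb{F}_q$-dimension $r$ with minimum Hamming distance exactly $d$. Then, for all sufficiently large $d$ (depending only on $q$, $r$ and $h$), the minimum length $n$ of an additive $[n,r/h,d]_q^h$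 code is the smallest integer $n$ with $g_q\left(r,q^{h-1}d\right)\le [h]_q\cdot n$. -/

import Mathlib

/-- `[i]_q = (q^i - 1) / (q - 1) = 1 + q + ⋯ + q^(i-1)`, the number of points of an
`i`-dimensional space over `𝔽_q`; in particular `[0]_q = 0`. -/
def qNumber (q i : ℕ) : ℕ := ∑ j ∈ Finset.range i, q ^ j

/-- The Griesmer sum `g_q(k, d) = ∑_{i=0}^{k-1} ⌈d / q^i⌉`. -/
def griesmerSum (q k : ℕ) (d : ℤ) : ℤ :=
  ∑ i ∈ Finset.range k, ⌈(d : ℚ) / (q : ℚ) ^ i⌉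

open Classical in
/-- A projective `h-(n,r,s)_q` system: a multiset of `n` subspaces of `F^r`, where `F = 𝔽_q`, each
of (vector space) dimension at most `h`, such that every hyperplane contains at most `s` of them
(counted with multiplicity) and some hyperplane contains exactly `s` of them. -/
structure IsProjectiveSystem (F : Type*) [Field F] (h n r s : ℕ)
    (S : Multiset (Submodule F (Fin r → F))) : Prop where
  card_eq : S.card = n
  finrank_le : ∀ U ∈ S, Module.finrank F U ≤ h
  count_le : ∀ H : Submodule F (Fin r → F), Module.finrank F H + 1 = r →
    S.countP (fun U => U ≤ H) ≤ s
  exists_count_eq : ∃ H : Submodule F (Fin r → F), Module.finrank F H + 1 = r ∧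
    S.countP (fun U => U ≤ H) = s

/-- `n = n_q(r,h;s)`: the number `n` is the maximum size of a projective `h-(n,r,s)_q` system
over `F = 𝔽_q`. -/
def IsMaxSystemSize (F : Type*) [Field F] (r h s n : ℕ) : Prop :=
  IsGreatest {m : ℕ | ∃ S : Multiset (Submodule F (Fin r → F)), IsProjectiveSystem F h m r s S} n

/-- `n` is the Griesmer upper bound for `n_q(r,h;s)`: the largest integer `n` such that
`g_q(r, q^(h-1) (n - s)) ≤ [h]_q n`. -/
def IsGriesmerUpperBound (q r h s : ℕ) (n : ℤ) : Prop :=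
  IsGreatest
    {m : ℤ | griesmerSum q r ((q : ℤ) ^ (h - 1) * (m - (s : ℤ))) ≤ (qNumber q h : ℤ) * m} n

open Classical in
/-- An additive `[n, r/h, d]_q^h` code, where `F = 𝔽_q` and the alphabet is the extension field `K`
of degree `h` over `F`: an `F`-linear subspace of `K^n` with `q^r` elements and with minimum
(Hamming) distance exactly `d`. -/
structure IsAdditiveCode (F K : Type*) [Field F] [Field K] [Algebra F K] (n r d : ℕ)
    (C : Submodule F (Fin n → K)) : Prop where
  finrank_eq : Module.finrank F C = r
  minDist_eq : IsLeast {w : ℕ | ∃ u ∈ C, ∃ v ∈ C, u ≠ v ∧ hammingDist u v = w} d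

/-- `n` is the minimum length of an additive `[n, r/h, d]_q^h` code with alphabet `K`, where `h` is
the degree of `K` over `F = 𝔽_q`. -/
def IsMinCodeLength (F K : Type*) [Field F] [Field K] [Algebra F K] (r d n : ℕ) : Prop :=
  IsLeast {m : ℕ | ∃ C : Submodule F (Fin m → K), IsAdditiveCode F K m r d C} n

/-- `n` is the Griesmer-type lower bound for the length of an additive `[n, r/h, d]_q^h` code: the
smallest integer `n` such that `g_q(r, q^(h-1) d) ≤ [h]_q n`. -/
def IsGriesmerLengthBound (q r h d : ℕ) (n : ℤ) : Prop :=
  IsLeast {m : ℤ | griesmerSum q r ((q : ℤ) ^ (h - 1) * (d : ℤ)) ≤ (qNumber q h : ℤ) * m} n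

open Module
open scoped LinearAlgebra.Projectivization

/-! ### Counting points and hyperplanes over a finite field -/

section Counting

variable {F V : Type*} [Field F] [AddCommGroup V] [Module F V]

/-! Both statements concern families of `n` subspaces such that at least `d` members lie outside
every hyperplane: the functional `f` is a codeword, its weight is the number of members outside `ker
f`, and `d = n - s` for systems.

Bound: replacing each alphabet symbol by its values at all functionals up to scalars (concatenation
with the simplex code) multiplies the length by `[h]_q` and the weights by `q^(h-1)`; the Griesmer
bound for linear codes then applies (`griesmer_bound_additive`).

Construction: negative multiplicities are allowed at first. Modulo the lattice spanned by the
indicators of `h`-spaces, the indicator of any `k`-space with `k ≥ h` is `[k]_q` times one fixed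
class killed by `[h]_q`. Hence a combination of spaces of dimension at least `h` lies in the lattice
as soon as `[h]_q` divides its weighted number of points (`sum_smul_pointIndicator_mem`). This is
applied to a Solomon-Stiffler type combination: one space of each dimension `h, ..., r`, with
coefficients built from `⌈d/q^j⌉`, nonpositive except on the whole space (`exists_signed`). Adding
all `h`-spaces equally often makes the multiplicities nonnegative. It shifts `d` and the bound in
step, so only finitely many residues of `d` matter and one threshold serves them all
(`exists_family`). Finally, members are degraded to the zero space until the minimum is exactly `d`.
-/

instance finite_dual [Finite F] [Finite V] : Finite (Dual F V) := DFunLike.finite _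

theorem Projectivization.rep_mk_mem_iff (A : Submodule F V) (v : V) (hv : v ≠ 0) :
    (Projectivization.mk F v hv).rep ∈ A ↔ v ∈ A := by
  obtain ⟨a, ha⟩ := Projectivization.exists_smul_eq_mk_rep F v hv
  rw [← ha]
  exact A.smul_mem_iff_of_isUnit a.isUnit

/-- The number of projective points in a subspace. -/
theorem card_points_mem [Finite F] (A : Submodule F V) :
    Nat.card {p : ℙ F V // p.rep ∈ A} = qNumber (Nat.card F) (finrank F A) := by
  rw [qNumber, ← Projectivization.card_of_finrank F A rfl]
  have hmem (p : ℙ F A) : (Projectivization.map A.subtype A.injective_subtype p).rep ∈ A := by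
    induction p using Projectivization.ind with
    | h v hv =>
      rw [Projectivization.map_mk, Projectivization.rep_mk_mem_iff]
      exact v.2
  refine (Nat.card_congr (Equiv.ofBijective (fun p : ℙ F A =>
    (⟨Projectivization.map A.subtype A.injective_subtype p, hmem p⟩ :
      {p : ℙ F V // p.rep ∈ A})) ⟨?_, ?_⟩)).symm
  · intro p p' h
    exact Projectivization.map_injective _ A.injective_subtype (congrArg Subtype.val h)
  · rintro ⟨p, hp⟩
    refine ⟨Projectivization.mk F ⟨p.rep, hp⟩ fun h => p.rep_nonzero (congrArg Subtype.val h), ?_⟩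
    apply Subtype.ext
    simp [Projectivization.map_mk]

/-- The number of hyperplanes above a subspace. -/
theorem card_hyperplanes_ge [Finite F] [FiniteDimensional F V] (W : Submodule F V) :
    Nat.card {p : ℙ F (Dual F V) // W ≤ LinearMap.ker p.rep} =
      qNumber (Nat.card F) (finrank F V - finrank F W) := by
  have h1 : finrank F W.dualAnnihilator = finrank F V - finrank F W := by
    have := Subspace.finrank_add_finrank_dualAnnihilator_eq W
    omega
  rw [← h1, ← card_points_mem]
  refine Nat.card_congr (Equiv.subtypeEquivRight fun p => ?_)
  rw [Submodule.mem_dualAnnihilator]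
  rfl

theorem exists_submodule_ge_finrank_eq [FiniteDimensional F V] (W : Submodule F V) {k : ℕ}
    (h1 : finrank F W ≤ k) (h2 : k ≤ finrank F V) :
    ∃ S : Submodule F V, W ≤ S ∧ finrank F S = k := by
  induction k, h1 using Nat.le_induction with
  | base => exact ⟨W, le_rfl, rfl⟩
  | succ k hk ih =>
    obtain ⟨S, hS, rfl⟩ := ih (by omega)
    obtain ⟨v, hv⟩ : ∃ v, v ∉ S := by
      by_contra! h
      rw [(Submodule.eq_top_iff'.2 h), finrank_top] at h2
      omega
    exact ⟨S ⊔ Submodule.span F {v}, hS.trans le_sup_left,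
      Submodule.finrank_sup_span_singleton hv⟩

theorem exists_linearEquiv_smul {x y : V} (hx : x ≠ 0) (hy : y ≠ 0) :
    ∃ (g : V ≃ₗ[F] V) (a : Fˣ), g x = a • y := by
  have : MulAction.IsPretransitive (V ≃ₗ[F] V) (ℙ F V) :=
    MulAction.isPretransitive_of_is_two_pretransitive
  obtain ⟨g, hg⟩ := MulAction.exists_smul_eq (V ≃ₗ[F] V)
    (Projectivization.mk F x hx) (Projectivization.mk F y hy)
  rw [Projectivization.smul_mk, Projectivization.mk_eq_mk_iff] at hg
  obtain ⟨a, ha⟩ := hg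
  exact ⟨g, a, ha.symm⟩

end Counting

/-! ### Identities for `[i]_q` -/

section QNumber

theorem qNumber_succ (q i : ℕ) : qNumber q (i + 1) = qNumber q i + q ^ i :=
  Finset.sum_range_succ _ _

theorem qNumber_succ' (q i : ℕ) : qNumber q (i + 1) = q * qNumber q i + 1 := by
  simp [qNumber, Finset.sum_range_succ', pow_succ', Finset.mul_sum]

theorem qNumber_mul_sub_one (q i : ℕ) : (qNumber q i : ℤ) * (q - 1) = q ^ i - 1 := by
  simp [qNumber, geom_sum_mul]

theorem qNumber_pos {q i : ℕ} (hi : 0 < i) : 0 < qNumber q i := by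
  obtain ⟨j, rfl⟩ := Nat.exists_eq_succ_of_ne_zero hi.ne'
  rw [Nat.succ_eq_add_one, qNumber_succ']
  omega

end QNumber

/-! ### The lattice generated by the `h`-spaces and its quotient -/

section Lattice

variable {F V : Type*} [Field F] [AddCommGroup V] [Module F V]

noncomputable instance fintype_projectivization [Finite V] : Fintype (ℙ F V) := Fintype.ofFinite _

open Classical in
/-- The indicator function of the set of nonzero vectors of a subspace. -/
noncomputable def pointIndicator (S : Submodule F V) : V → ℤ :=
  fun x => if x ∈ S ∧ x ≠ 0 then 1 else 0

/-- The hyperplane of the subspace `S` given by a projective point of the dual of `S`. -/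
noncomputable def hyperplaneIn (S : Submodule F V) (p : ℙ F (Dual F S)) : Submodule F V :=
  (LinearMap.ker p.rep).map S.subtype

theorem hyperplaneIn_le (S : Submodule F V) (p : ℙ F (Dual F S)) : hyperplaneIn S p ≤ S :=
  Submodule.map_subtype_le _ _

theorem finrank_hyperplaneIn [FiniteDimensional F V] (S : Submodule F V) (p : ℙ F (Dual F S)) :
    finrank F (hyperplaneIn S p) + 1 = finrank F S := by
  rw [hyperplaneIn, Submodule.finrank_map_subtype_eq]
  exact Dual.finrank_ker_add_one_of_ne_zero p.rep_nonzero

variable (F V) in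
/-- The lattice spanned by the indicator functions of the `h`-dimensional subspaces. -/
noncomputable def subspaceLattice (h : ℕ) : Submodule ℤ (V → ℤ) :=
  Submodule.span ℤ (Set.range fun U : {U : Submodule F V // finrank F U = h} => pointIndicator U.1)

theorem mkQ_pointIndicator_eq_zero {h : ℕ} {U : Submodule F V} (hU : finrank F U = h) :
    (subspaceLattice F V h).mkQ (pointIndicator U) = 0 := by
  rw [Submodule.mkQ_apply, Submodule.Quotient.mk_eq_zero]
  exact Submodule.subset_span ⟨⟨U, hU⟩, rfl⟩

/-- The number of nonzero vectors of a subspace. -/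
theorem sum_pointIndicator [Fintype V] (S : Submodule F V) :
    ∑ x, pointIndicator S x = (Nat.card F : ℤ) ^ finrank F S - 1 := by
  classical
  have h1 : ∑ x, pointIndicator S x = ∑ x, ((if x ∈ S then 1 else 0) - if x = 0 then 1 else 0) := by
    refine Finset.sum_congr rfl fun x _ => ?_
    by_cases hx : x = 0
    · simp [pointIndicator, hx]
    · simp [pointIndicator, hx]
  rw [h1, Finset.sum_sub_distrib, Finset.sum_boole, Finset.sum_ite_eq' Finset.univ (0 : V),
    if_pos (Finset.mem_univ _), ← Fintype.card_subtype, ← Nat.card_eq_fintype_card]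
  have h2 := Module.natCard_eq_pow_finrank (K := F) (V := S)
  have h3 : Nat.card {x // x ∈ S} = Nat.card F ^ finrank F S := h2
  rw [h3]
  push_cast
  ring

open Classical in
/-- The number of vectors of a subspace off a hyperplane, scaled by `q`. -/
theorem sum_pointIndicator_off_ker [Fintype V] (S : Submodule F V) (f : Dual F V) :
    (Nat.card F : ℤ) * ∑ x with f x ≠ 0, pointIndicator S x =
      if S ≤ LinearMap.ker f then 0
      else ((Nat.card F : ℤ) - 1) * (Nat.card F : ℤ) ^ finrank F S := by
  have h1 : ∑ x with f x ≠ 0, pointIndicator S x =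
      ∑ x, pointIndicator S x - ∑ x, pointIndicator (S ⊓ LinearMap.ker f) x := by
    rw [Finset.sum_filter, ← Finset.sum_sub_distrib]
    refine Finset.sum_congr rfl fun x _ => ?_
    by_cases hx : f x = 0 <;> simp [pointIndicator, hx]
  rw [h1, sum_pointIndicator, sum_pointIndicator]
  split_ifs with h
  · rw [inf_eq_left.2 h, sub_self, mul_zero]
  · have h2 : finrank F (S ⊓ LinearMap.ker f : Submodule F V) + 1 = finrank F S := by
      have h3 : f.domRestrict S ≠ 0 := fun h0 => h fun x hx => by
        simpa using LinearMap.congr_fun h0 ⟨x, hx⟩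
      have h4 := Dual.finrank_ker_add_one_of_ne_zero (f := f.domRestrict S) h3
      rwa [← Submodule.finrank_map_subtype_eq, LinearMap.ker_domRestrict,
        Submodule.map_comap_subtype] at h4
    rw [← h2]
    ring

variable [Finite F] [Finite V]

open Classical in
theorem card_hyperplaneIn_ge {S W : Submodule F V} (hW : W ≤ S) :
    (Finset.univ.filter fun p : ℙ F (Dual F S) => W ≤ hyperplaneIn S p).card =
      qNumber (Nat.card F) (finrank F S - finrank F W) := by
  have h := card_hyperplanes_ge (F := F) (W.submoduleOf S)
  rw [(Submodule.submoduleOfEquivOfLe hW).finrank_eq] at h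
  rw [← h, Nat.card_eq_fintype_card, Fintype.card_subtype]
  congr 1
  ext p
  simp only [Finset.mem_filter, Finset.mem_univ, true_and]
  constructor
  · intro h x hx
    obtain ⟨y, hy, hxy⟩ := h hx
    rwa [Subtype.ext hxy] at hy
  · intro h x hx
    exact ⟨⟨x, hW hx⟩, h (show (⟨x, hW hx⟩ : S) ∈ W.submoduleOf S from hx), rfl⟩

open Classical in
theorem sum_pointIndicator_hyperplaneIn_apply (S W : Submodule F V) (hW : W ≤ S) (y : V) :
    (∑ p : ℙ F (Dual F S) with W ≤ hyperplaneIn S p, pointIndicator (hyperplaneIn S p) y) =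
      pointIndicator S y *
        qNumber (Nat.card F) (finrank F S - finrank F (W ⊔ Submodule.span F {y} : Submodule F V)) := by
  by_cases hy : y ∈ S ∧ y ≠ 0
  · have hle : W ⊔ Submodule.span F {y} ≤ S :=
      sup_le hW ((Submodule.span_singleton_le_iff_mem _ _).2 hy.1)
    rw [← card_hyperplaneIn_ge hle]
    simp only [pointIndicator, hy, ne_eq, not_false_eq_true, and_true, and_self, if_true,
      one_mul, Finset.sum_boole, Finset.filter_filter, sup_le_iff,
      Submodule.span_singleton_le_iff_mem]
  · have h0 : pointIndicator S y = 0 := if_neg hy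
    rw [h0, zero_mul]
    refine Finset.sum_eq_zero fun p _ => if_neg fun h => hy ⟨hyperplaneIn_le S p h.1, h.2⟩

theorem sum_pointIndicator_hyperplaneIn {S : Submodule F V} {k : ℕ} (hS : finrank F S = k + 1) :
    ∑ p : ℙ F (Dual F S), pointIndicator (hyperplaneIn S p) =
      (qNumber (Nat.card F) k : ℤ) • pointIndicator S := by
  classical
  ext y
  have h := sum_pointIndicator_hyperplaneIn_apply S ⊥ bot_le y
  simp only [bot_le, Finset.filter_true, hS] at h
  rw [Finset.sum_apply, h, Pi.smul_apply, smul_eq_mul, mul_comm]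
  by_cases hy : y = 0
  · simp [pointIndicator, hy]
  · rw [bot_sup_eq, finrank_span_singleton hy, Nat.add_sub_cancel]

open Classical in
-- A nonzero `y ∈ S` lies on `[k]` hyperplanes of `S`. Those also containing `x` number `[k]` if `y
-- ∈ ⟨x⟩` and `[k-1]` otherwise, so the identity reads `[k] - q[k] + q^k = 1` or `[k] - q[k-1] = 1`.
theorem pointIndicator_eq_sum {S : Submodule F V} {k : ℕ} (hS : finrank F S = k + 1) {x : V}
    (hxS : x ∈ S) (hx : x ≠ 0) :
    pointIndicator S = ∑ p : ℙ F (Dual F S), pointIndicator (hyperplaneIn S p)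
      - (Nat.card F : ℤ) • (∑ p : ℙ F (Dual F S) with Submodule.span F {x} ≤ hyperplaneIn S p,
        pointIndicator (hyperplaneIn S p))
      + ((Nat.card F : ℤ) ^ k) • pointIndicator (Submodule.span F {x}) := by
  have hxle := (Submodule.span_singleton_le_iff_mem x S).2 hxS
  rw [sum_pointIndicator_hyperplaneIn hS]
  ext y
  simp only [Pi.add_apply, Pi.sub_apply, Pi.smul_apply, smul_eq_mul, Finset.sum_apply,
    sum_pointIndicator_hyperplaneIn_apply S _ hxle y, hS]
  by_cases hy : y ∈ S ∧ y ≠ 0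
  · have h1 : pointIndicator S y = 1 := if_pos hy
    rw [h1]
    by_cases hyx : y ∈ Submodule.span F {x}
    · have h2 : pointIndicator (Submodule.span F {x}) y = 1 := if_pos ⟨hyx, hy.2⟩
      rw [sup_eq_left.2 ((Submodule.span_singleton_le_iff_mem _ _).2 hyx),
        finrank_span_singleton hx, h2, Nat.add_sub_cancel]
      linear_combination qNumber_mul_sub_one (Nat.card F) k
    · have h2 : pointIndicator (Submodule.span F {x}) y = 0 := if_neg fun h => hyx h.1
      have h3 := Submodule.finrank_sup_span_singleton hyx
      have h4 : finrank F (Submodule.span F {x} ⊔ Submodule.span F {y} : Submodule F V) ≤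
        finrank F S := Submodule.finrank_mono
          (sup_le hxle ((Submodule.span_singleton_le_iff_mem _ _).2 hy.1))
      rw [finrank_span_singleton hx] at h3
      obtain ⟨j, rfl⟩ : ∃ j, k = j + 1 := ⟨k - 1, by omega⟩
      rw [h3, h2, show j + 1 + 1 - (1 + 1) = j by omega, qNumber_succ']
      push_cast
      ring
  · have h1 : pointIndicator S y = 0 := if_neg hy
    have h2 : pointIndicator (Submodule.span F {x}) y = 0 :=
      if_neg fun h => hy ⟨hxle h.1, h.2⟩
    simp [h1, h2]

theorem qNumber_smul_mkQ_pointIndicator {h : ℕ} {S : Submodule F V} (hS : finrank F S = h + 1) :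
    (qNumber (Nat.card F) h : ℤ) • (subspaceLattice F V h).mkQ (pointIndicator S) = 0 := by
  rw [← map_smul, ← sum_pointIndicator_hyperplaneIn hS, map_sum]
  refine Finset.sum_eq_zero fun p _ => mkQ_pointIndicator_eq_zero ?_
  have := finrank_hyperplaneIn S p
  omega

/-- All hyperplanes of `S` are `h`-spaces, so only the point term of `pointIndicator_eq_sum`
survives in the quotient. -/
theorem mkQ_pointIndicator_succ {h : ℕ} {S : Submodule F V} (hS : finrank F S = h + 1)
    {x : V} (hxS : x ∈ S) (hx : x ≠ 0) :
    (subspaceLattice F V h).mkQ (pointIndicator S) =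
      ((Nat.card F : ℤ) ^ h) •
        (subspaceLattice F V h).mkQ (pointIndicator (Submodule.span F {x})) := by
  have hz (p : ℙ F (Dual F S)) :
      (subspaceLattice F V h).mkQ (pointIndicator (hyperplaneIn S p)) = 0 := by
    refine mkQ_pointIndicator_eq_zero ?_
    have := finrank_hyperplaneIn S p
    omega
  conv_lhs => rw [pointIndicator_eq_sum hS hxS hx]
  simp only [map_add, map_sub, map_smul, map_sum, hz, Finset.sum_const_zero, smul_zero, sub_zero,
    zero_add]

theorem qNumber_smul_mkQ_span_singleton {h : ℕ} (hV : h < finrank F V) {x : V} (hx : x ≠ 0) :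
    (qNumber (Nat.card F) h : ℤ) • ((Nat.card F : ℤ) ^ h) •
        (subspaceLattice F V h).mkQ (pointIndicator (Submodule.span F {x})) = 0 := by
  obtain ⟨S, hxS, hS⟩ := exists_submodule_ge_finrank_eq (Submodule.span F {x}) (k := h + 1)
    (by rw [finrank_span_singleton hx]; omega) hV
  rw [← mkQ_pointIndicator_succ hS (hxS (Submodule.mem_span_singleton_self x)) hx,
    qNumber_smul_mkQ_pointIndicator hS]

/-- As `h ≥ 1`, two points lie in a common `(h+1)`-space, whose class equals both sides. -/
theorem mkQ_span_singleton_congr {h : ℕ} (hh : 1 ≤ h) (hV : h < finrank F V) {x y : V}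
    (hx : x ≠ 0) (hy : y ≠ 0) :
    ((Nat.card F : ℤ) ^ h) •
        (subspaceLattice F V h).mkQ (pointIndicator (Submodule.span F {x})) =
      ((Nat.card F : ℤ) ^ h) •
        (subspaceLattice F V h).mkQ (pointIndicator (Submodule.span F {y})) := by
  obtain ⟨S, hle, hS⟩ := exists_submodule_ge_finrank_eq
    (Submodule.span F {x} ⊔ Submodule.span F {y}) (k := h + 1)
    (by
      have := Submodule.finrank_add_le_finrank_add_finrank (Submodule.span F {x})
        (Submodule.span F {y})
      rw [finrank_span_singleton hx, finrank_span_singleton hy] at this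
      omega) hV
  rw [← mkQ_pointIndicator_succ hS (hle (Submodule.mem_sup_left
      (Submodule.mem_span_singleton_self x))) hx,
    ← mkQ_pointIndicator_succ hS (hle (Submodule.mem_sup_right
      (Submodule.mem_span_singleton_self y))) hy]

/-- Induction on `k`, expanding `S` by `pointIndicator_eq_sum`: every hyperplane of `S` has the same
class by induction, and the point term is a power of `q` times the fixed class `P`. -/
theorem mkQ_pointIndicator_eq_smul {h : ℕ} (hh : 1 ≤ h) (hV : h < finrank F V) {x : V}
    (hx : x ≠ 0) {k : ℕ} (hk : h ≤ k) (S : Submodule F V) (hS : finrank F S = k) :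
    (subspaceLattice F V h).mkQ (pointIndicator S) =
      (qNumber (Nat.card F) k : ℤ) • ((Nat.card F : ℤ) ^ h) •
        (subspaceLattice F V h).mkQ (pointIndicator (Submodule.span F {x})) := by
  classical
  induction k, hk using Nat.le_induction generalizing S with
  | base => rw [mkQ_pointIndicator_eq_zero hS, qNumber_smul_mkQ_span_singleton hV hx]
  | succ k hk ih =>
    obtain ⟨y, hyS, hy⟩ : ∃ y ∈ S, y ≠ 0 := by
      refine S.exists_mem_ne_zero_of_ne_bot fun h => ?_
      rw [h, finrank_bot] at hS
      omega
    set P := ((Nat.card F : ℤ) ^ h) •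
        (subspaceLattice F V h).mkQ (pointIndicator (Submodule.span F {x})) with hP
    have hPy : ((Nat.card F : ℤ) ^ h) •
        (subspaceLattice F V h).mkQ (pointIndicator (Submodule.span F {y})) = P :=
      mkQ_span_singleton_congr hh hV hy hx
    have hP0 : (qNumber (Nat.card F) h : ℤ) • P = 0 := qNumber_smul_mkQ_span_singleton hV hx
    have hz (p : ℙ F (Dual F S)) :
        (subspaceLattice F V h).mkQ (pointIndicator (hyperplaneIn S p)) =
          (qNumber (Nat.card F) k : ℤ) • P := by
      refine ih _ ?_
      have := finrank_hyperplaneIn S p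
      omega
    have hc1 := card_hyperplaneIn_ge (bot_le : ⊥ ≤ S)
    have hc2 := card_hyperplaneIn_ge ((Submodule.span_singleton_le_iff_mem y S).2 hyS)
    simp only [bot_le, Finset.filter_true, finrank_bot, hS, Nat.sub_zero] at hc1
    rw [hS, finrank_span_singleton hy, Nat.add_sub_cancel] at hc2
    conv_lhs => rw [pointIndicator_eq_sum hS hyS hy]
    simp only [map_add, map_sub, map_smul, map_sum, hz, Finset.sum_const, hc1, hc2]
    obtain ⟨j, rfl⟩ := Nat.exists_eq_add_of_le hk
    rw [add_comm h j, pow_add, mul_smul, hPy, add_comm j h]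
    have hq := qNumber_mul_sub_one (Nat.card F) h
    -- `q^h - 1 = (q - 1)[h]` kills `P`. The point term `q^j P` may therefore be replaced by
    -- `q^(h+j) P`, which makes the coefficients add up to `[k+1]`.
    have key : ((Nat.card F : ℤ) ^ h) • P = P := by
      rw [← sub_eq_zero]
      nth_rewrite 2 [← one_smul ℤ P]
      rw [← sub_smul, ← hq, mul_comm, mul_smul, hP0, smul_zero]
    have hj : ((Nat.card F : ℤ) ^ j) • P = ((Nat.card F : ℤ) ^ (h + j)) • P := by
      rw [add_comm h j, pow_add, mul_smul, key]
    have hcoef : (qNumber (Nat.card F) (h + j + 1) : ℤ) * qNumber (Nat.card F) (h + j)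
        - Nat.card F * (qNumber (Nat.card F) (h + j) * qNumber (Nat.card F) (h + j))
        + (Nat.card F : ℤ) ^ (h + j) = qNumber (Nat.card F) (h + j + 1) := by
      have h1 : (qNumber (Nat.card F) (h + j + 1) : ℤ) = _ :=
        congrArg Nat.cast (qNumber_succ (Nat.card F) (h + j))
      have h2 : (qNumber (Nat.card F) (h + j + 1) : ℤ) = _ :=
        congrArg Nat.cast (qNumber_succ' (Nat.card F) (h + j))
      push_cast at h1 h2
      linear_combination (qNumber (Nat.card F) (h + j) : ℤ) * h2 - h1
    rw [hj, ← hcoef]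
    simp only [← natCast_zsmul]
    module

theorem sum_smul_pointIndicator_mem {h : ℕ} (hh : 1 ≤ h) (hV : h < finrank F V) {ι : Type*}
    (s : Finset ι) (a : ι → ℤ) (S : ι → Submodule F V) (hS : ∀ i ∈ s, h ≤ finrank F (S i))
    (hdvd : (qNumber (Nat.card F) h : ℤ) ∣
      ∑ i ∈ s, a i * (qNumber (Nat.card F) (finrank F (S i)) : ℤ)) :
    ∑ i ∈ s, a i • pointIndicator (S i) ∈ subspaceLattice F V h := by
  have : Nontrivial V := nontrivial_of_finrank_pos (R := F) (by omega)
  obtain ⟨x, hx⟩ := exists_ne (0 : V)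
  rw [← Submodule.Quotient.mk_eq_zero, ← Submodule.mkQ_apply]
  simp only [map_sum, map_smul]
  rw [Finset.sum_congr rfl fun i hi => by
    rw [mkQ_pointIndicator_eq_smul hh hV hx (hS i hi) (S i) rfl, smul_smul], ← Finset.sum_smul]
  obtain ⟨c, hc⟩ := hdvd
  rw [hc, mul_comm, mul_smul, qNumber_smul_mkQ_span_singleton hV hx, smul_zero]

end Lattice

/-! ### Griesmer sums at multiples of `q^(h-1)` -/

section GriesmerSum

/-- The first `h` quotients are integers and add up to `[h]_q d`; only the last `m` involve
rounding. -/
theorem griesmerSum_eq {q h : ℕ} (hq : 0 < q) (hh : 1 ≤ h) (m : ℕ) (d : ℤ) :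
    griesmerSum q (h + m) ((q : ℤ) ^ (h - 1) * d) =
      (qNumber q h : ℤ) * d + ∑ j ∈ Finset.range m, ⌈(d : ℚ) / (q : ℚ) ^ (j + 1)⌉ := by
  have hq' : (q : ℚ) ≠ 0 := by positivity
  obtain ⟨k, rfl⟩ := Nat.exists_eq_add_of_le' hh
  rw [griesmerSum, Finset.sum_range_add]
  congr 1
  · rw [qNumber, ← Finset.sum_range_reflect, Nat.cast_sum, Finset.sum_mul]
    refine Finset.sum_congr rfl fun i hi => ?_
    rw [Finset.mem_range] at hi
    have h1 : (((q : ℤ) ^ (k + 1 - 1) * d : ℤ) : ℚ) / (q : ℚ) ^ (k + 1 - 1 - i) =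
        (((q ^ i : ℕ) : ℤ) * d : ℤ) := by
      rw [div_eq_iff (by positivity), Nat.add_sub_cancel]
      push_cast
      rw [mul_right_comm, ← pow_add, show i + (k - i) = k by omega]
    rw [h1, Int.ceil_intCast]
  · refine Finset.sum_congr rfl fun j _ => ?_
    congr 1
    rw [show k + 1 + j = (k + 1 - 1) + (j + 1) by omega, pow_add]
    push_cast
    rw [mul_div_mul_left _ _ (by positivity)]

theorem griesmerSum_mono {q k : ℕ} {d d' : ℤ} (h : d ≤ d') :
    griesmerSum q k d ≤ griesmerSum q k d' := by
  refine Finset.sum_le_sum fun i _ => Int.ceil_le_ceil ?_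
  have : (d : ℚ) ≤ d' := by exact_mod_cast h
  gcongr

/-- The increment is a multiple of `q^(r-1)` for `r = h + m`, so every quotient moves by an integer.
-/
theorem griesmerSum_add_mul {q h : ℕ} (hq : 0 < q) (hh : 1 ≤ h) (m : ℕ) (d k : ℤ) :
    griesmerSum q (h + m) ((q : ℤ) ^ (h - 1) * (d + k * (q : ℤ) ^ m)) =
      griesmerSum q (h + m) ((q : ℤ) ^ (h - 1) * d) + k * (qNumber q (h + m) : ℤ) := by
  have hq' : (q : ℚ) ≠ 0 := by positivity
  have h1 : (qNumber q (h + m) : ℤ) = ∑ i ∈ Finset.range (h + m), (q : ℤ) ^ (h + m - 1 - i) := by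
    rw [qNumber, ← Finset.sum_range_reflect]
    push_cast
    rfl
  rw [griesmerSum, griesmerSum, h1, Finset.mul_sum, ← Finset.sum_add_distrib]
  refine Finset.sum_congr rfl fun i hi => ?_
  rw [Finset.mem_range] at hi
  rw [← Int.ceil_add_intCast]
  congr 1
  rw [div_add' _ _ _ (by positivity)]
  congr 1
  push_cast
  rw [mul_assoc (k : ℚ), ← pow_add, show h + m - 1 - i + i = (h - 1) + m by omega, pow_add]
  ring

end GriesmerSum

/-! ### Systems with signed multiplicities -/

section SignedSystems

variable {F V : Type*} [Field F] [AddCommGroup V] [Module F V] [Finite V]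

noncomputable instance fintype_submodule_finrank (h : ℕ) :
    Fintype {U : Submodule F V // finrank F U = h} := Fintype.ofFinite _

/-- The general linear group permutes the `h`-spaces and is transitive on points, so every point is
covered equally often. -/
theorem exists_sum_pointIndicator_eq {h : ℕ} (hh : 1 ≤ h) (hV : h ≤ finrank F V) :
    ∃ N : ℕ, 0 < N ∧ ∑ U : {U : Submodule F V // finrank F U = h}, pointIndicator U.1 =
      (N : ℤ) • pointIndicator (⊤ : Submodule F V) := by
  classical
  have : Nontrivial V := nontrivial_of_finrank_pos (R := F) (by omega)
  obtain ⟨x, hx⟩ := exists_ne (0 : V)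
  refine ⟨(Finset.univ.filter
    fun U : {U : Submodule F V // finrank F U = h} => x ∈ U.1).card, ?_, ?_⟩
  · obtain ⟨U, hxU, hU⟩ := exists_submodule_ge_finrank_eq (Submodule.span F {x}) (k := h)
      (by rwa [finrank_span_singleton hx]) hV
    exact Finset.card_pos.2 ⟨⟨U, hU⟩, by simpa using hxU⟩
  · ext y
    by_cases hy : y = 0
    · simp [pointIndicator, hy]
    · simp only [Finset.sum_apply, pointIndicator, hy, ne_eq, not_false_eq_true, and_true,
        Pi.smul_apply, Submodule.mem_top, if_true, smul_eq_mul, mul_one, Finset.sum_boole]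
      norm_cast
      obtain ⟨g, a, hga⟩ := exists_linearEquiv_smul (F := F) hy hx
      refine Finset.card_bij (fun U _ => ⟨U.1.map g.toLinearMap, ?_⟩) ?_ ?_ ?_
      · rw [LinearEquiv.finrank_map_eq, U.2]
      · intro U hU
        simp only [Finset.mem_filter, Finset.mem_univ, true_and] at hU ⊢
        have h1 : g y ∈ U.1.map g.toLinearMap := Submodule.mem_map_of_mem hU
        rw [hga] at h1
        exact (Submodule.smul_mem_iff_of_isUnit _ a.isUnit).1 h1
      · intro U _ U' _ hUU
        exact Subtype.ext (Submodule.map_injective_of_injective g.injective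
          (congrArg Subtype.val hUU))
      · intro U hU
        simp only [Finset.mem_filter, Finset.mem_univ, true_and] at hU
        refine ⟨⟨U.1.map g.symm.toLinearMap, by rw [LinearEquiv.finrank_map_eq, U.2]⟩, ?_, ?_⟩
        · simp only [Finset.mem_filter, Finset.mem_univ, true_and]
          refine ⟨g y, ?_, by simp⟩
          rw [hga]
          exact U.1.smul_mem (a : F) hU
        · apply Subtype.ext
          simp [← Submodule.map_comp]

variable [Finite F]

theorem one_lt_natCard (F : Type*) [Field F] [Finite F] : (1 : ℤ) < Nat.card F := by
  exact_mod_cast Finite.one_lt_card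

/-- Comparison of a combination of `h`-dimensional subspaces with a combination of arbitrary
subspaces having the same point multiplicities: number of members. -/
theorem qNumber_mul_sum_eq {h : ℕ} (c : {U : Submodule F V // finrank F U = h} → ℤ)
    {ι : Type*} (s : Finset ι) (a : ι → ℤ) (S : ι → Submodule F V)
    (hc : ∑ U, c U • pointIndicator U.1 = ∑ i ∈ s, a i • pointIndicator (S i)) :
    (qNumber (Nat.card F) h : ℤ) * ∑ U, c U =
      ∑ i ∈ s, a i * (qNumber (Nat.card F) (finrank F (S i)) : ℤ) := by
  have := Fintype.ofFinite V
  have hq := one_lt_natCard F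
  have h1 := congrArg (fun g : V → ℤ => ∑ x, g x) hc
  simp only [Finset.sum_apply, Pi.smul_apply, smul_eq_mul] at h1
  rw [Finset.sum_comm, Finset.sum_comm (s := Finset.univ) (t := s)] at h1
  simp only [← Finset.mul_sum, sum_pointIndicator, ← qNumber_mul_sub_one] at h1
  apply mul_right_cancel₀ (sub_ne_zero.2 hq.ne')
  rw [Finset.sum_mul, Finset.mul_sum, Finset.sum_mul]
  convert h1 using 1
  · refine Finset.sum_congr rfl fun U _ => ?_
    rw [U.2]
    ring
  · refine Finset.sum_congr rfl fun U _ => ?_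
    ring

open Classical in
/-- Comparison of a combination of `h`-dimensional subspaces with a combination of arbitrary
subspaces having the same point multiplicities: number of members outside a hyperplane. -/
theorem pow_mul_sum_off_ker_eq {h : ℕ} (c : {U : Submodule F V // finrank F U = h} → ℤ)
    {ι : Type*} (s : Finset ι) (a : ι → ℤ) (S : ι → Submodule F V)
    (hc : ∑ U, c U • pointIndicator U.1 = ∑ i ∈ s, a i • pointIndicator (S i)) (f : Dual F V) :
    (Nat.card F : ℤ) ^ h * ∑ U with ¬ U.1 ≤ LinearMap.ker f, c U =
      ∑ i ∈ s, if S i ≤ LinearMap.ker f then 0 else a i * (Nat.card F : ℤ) ^ finrank F (S i) := by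
  have := Fintype.ofFinite V
  have hq := one_lt_natCard F
  have h1 := congrArg (fun g : V → ℤ => (Nat.card F : ℤ) * ∑ x with f x ≠ 0, g x) hc
  simp only [Finset.sum_apply, Pi.smul_apply, smul_eq_mul] at h1
  rw [Finset.sum_comm, Finset.sum_comm (t := s)] at h1
  simp only [← Finset.mul_sum] at h1
  rw [Finset.mul_sum, Finset.mul_sum] at h1
  simp only [mul_left_comm (Nat.card F : ℤ), sum_pointIndicator_off_ker] at h1
  apply mul_right_cancel₀ (sub_ne_zero.2 hq.ne')
  rw [Finset.sum_filter, Finset.mul_sum, Finset.sum_mul, Finset.sum_mul]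
  convert h1 using 1
  · refine Finset.sum_congr rfl fun U _ => ?_
    rw [U.2]
    split_ifs <;> first | contradiction | ring
  · refine Finset.sum_congr rfl fun U _ => ?_
    split_ifs <;> ring

theorem sum_sub_mul_qNumber (q h : ℕ) (b : ℕ → ℤ) (M : ℕ) :
    ∑ j ∈ Finset.range M, (b j - q * b (j + 1)) * (qNumber q (h + j) : ℤ) =
      (qNumber q h : ℤ) * b 0 + ∑ j ∈ Finset.range M, b (j + 1)
        - b M * (qNumber q (h + M) : ℤ) := by
  induction M with
  | zero => simp; ring
  | succ M ih =>
    rw [Finset.sum_range_succ, ih, Finset.sum_range_succ, ← add_assoc h M 1, qNumber_succ']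
    push_cast
    ring

theorem sum_sub_mul_pow (q : ℤ) (h : ℕ) (b : ℕ → ℤ) (M : ℕ) :
    ∑ j ∈ Finset.range M, (b j - q * b (j + 1)) * q ^ (h + j) =
      q ^ h * b 0 - b M * q ^ (h + M) := by
  induction M with
  | zero => simp; ring
  | succ M ih =>
    rw [Finset.sum_range_succ, ih]
    ring

open Classical in
-- The combination gives a space `S j` of dimension `h + j` the coefficient `b j - q * b (j + 1)`.
-- Both the point count and the count outside a hyperplane telescope. `hsum` makes the former `[h]_q
-- n`, which yields membership in the lattice.
theorem exists_signed_of_seq {h m : ℕ} (hh : 1 ≤ h) (hm : 1 ≤ m) (hV : finrank F V = h + m)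
    (n : ℤ) (b : ℕ → ℤ) (hb : ∀ j < m, b j ≤ Nat.card F * b (j + 1)) (hb0 : b (m + 1) = 0)
    (hsum : ∑ j ∈ Finset.range m, b (j + 1) = (qNumber (Nat.card F) h : ℤ) * (n - b 0)) :
    ∃ c : {U : Submodule F V // finrank F U = h} → ℤ, ∑ U, c U = n ∧
      ∀ f : Dual F V, f ≠ 0 → b 0 ≤ ∑ U with ¬ U.1 ≤ LinearMap.ker f, c U := by
  have hq := one_lt_natCard F
  have hex (j : ℕ) : ∃ S : Submodule F V, j < m + 1 → finrank F S = h + j := by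
    by_cases hj : j < m + 1
    · obtain ⟨S, -, hS⟩ := exists_submodule_ge_finrank_eq (⊥ : Submodule F V) (k := h + j)
        (by simp) (by omega)
      exact ⟨S, fun _ => hS⟩
    · exact ⟨⊥, fun h => absurd h hj⟩
  choose S hS using hex
  have hcard : ∑ j ∈ Finset.range (m + 1),
      (b j - Nat.card F * b (j + 1)) * (qNumber (Nat.card F) (finrank F (S j)) : ℤ) =
        (qNumber (Nat.card F) h : ℤ) * n := by
    rw [Finset.sum_congr rfl fun j hj => by rw [hS j (Finset.mem_range.1 hj)],
      sum_sub_mul_qNumber, hb0, Finset.sum_range_succ, hb0, hsum]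
    ring
  have hmem := sum_smul_pointIndicator_mem hh (by omega) (Finset.range (m + 1))
    (fun j => b j - Nat.card F * b (j + 1)) S
    (fun j hj => by rw [hS j (Finset.mem_range.1 hj)]; omega) ⟨n, hcard⟩
  obtain ⟨c, hc⟩ := (Submodule.mem_span_range_iff_exists_fun ℤ).1 hmem
  refine ⟨c, ?_, fun f hf => ?_⟩
  · have h1 := qNumber_mul_sum_eq c _ _ _ hc
    rw [hcard] at h1
    have h2 : (qNumber (Nat.card F) h : ℤ) ≠ 0 := by exact_mod_cast (qNumber_pos hh).ne'
    exact mul_left_cancel₀ h2 h1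
  · have h1 := pow_mul_sum_off_ker_eq c _ _ _ hc f
    have h2 := sum_sub_mul_pow (Nat.card F : ℤ) h b (m + 1)
    rw [hb0, zero_mul, sub_zero] at h2
    have h3 : (0 : ℤ) < (Nat.card F : ℤ) ^ h := by positivity
    refine le_of_mul_le_mul_left ?_ h3
    rw [h1, ← h2]
    -- If no `S j` lay in the hyperplane, the count would be exactly `b 0`. Those that do have `j <
    -- m`, and dropping their nonpositive terms only increases the sum.
    refine Finset.sum_le_sum fun j hj => ?_
    rw [Finset.mem_range] at hj
    rw [hS j hj]
    split_ifs with hle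
    · have hjm : j < m := by
        rcases Nat.lt_succ_iff_lt_or_eq.1 hj with h | rfl
        · exact h
        · have htop : S j = ⊤ := Submodule.eq_top_of_finrank_eq (by rw [hS j hj, hV])
          rw [htop, top_le_iff, LinearMap.ker_eq_top] at hle
          exact absurd hle hf
      have := hb j hjm
      exact mul_nonpos_of_nonpos_of_nonneg (by linarith) (by positivity)
    · exact le_rfl

open Classical in
/-- Any admissible length is attained if negative multiplicities are allowed. -/
theorem exists_signed {h m : ℕ} (hh : 1 ≤ h) (hm : 1 ≤ m) (hV : finrank F V = h + m)
    (n d : ℤ) (hn : griesmerSum (Nat.card F) (h + m) ((Nat.card F : ℤ) ^ (h - 1) * d) ≤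
      (qNumber (Nat.card F) h : ℤ) * n) :
    ∃ c : {U : Submodule F V // finrank F U = h} → ℤ, ∑ U, c U = n ∧
      ∀ f : Dual F V, f ≠ 0 → d ≤ ∑ U with ¬ U.1 ≤ LinearMap.ker f, c U := by
  have hq := one_lt_natCard F
  have hq0 : 0 < Nat.card F := Nat.card_pos
  rw [griesmerSum_eq hq0 hh] at hn
  obtain ⟨k, rfl⟩ := Nat.exists_eq_add_of_le' hm
  set u : ℕ → ℤ := fun j => ⌈(d : ℚ) / (Nat.card F : ℚ) ^ j⌉ with hu
  have hu0 : u 0 = d := by simp [hu]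
  have hstep (j : ℕ) : u j ≤ Nat.card F * u (j + 1) := by
    rw [hu, Int.ceil_le]
    push_cast
    have h1 : (d : ℚ) / (Nat.card F : ℚ) ^ j =
        Nat.card F * ((d : ℚ) / (Nat.card F : ℚ) ^ (j + 1)) := by
      have : (Nat.card F : ℚ) ≠ 0 := by positivity
      rw [pow_succ]
      field_simp
    rw [h1]
    gcongr
    exact Int.le_ceil _
  set R : ℤ := (qNumber (Nat.card F) h : ℤ) * (n - d) - ∑ j ∈ Finset.range k, u (j + 1) with hR
  rw [Finset.sum_range_succ] at hn
  have hRu : u (k + 1) ≤ R := by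
    rw [hR, mul_sub]
    simp only [hu]
    linarith
  set b : ℕ → ℤ := fun j => if j < k + 1 then u j else if j = k + 1 then R else 0 with hb
  have hb0 : b 0 = d := by simp [hb, hu0]
  rw [← hb0]
  refine exists_signed_of_seq hh hm hV n b (fun j hj => ?_) (by simp [hb]) ?_
  · simp only [hb, hj, if_true]
    split_ifs with h1 h2
    · exact hstep j
    · have : j = k := by omega
      subst this
      exact (hstep j).trans (by gcongr)
    · omega
  · rw [hb0, Finset.sum_range_succ,
      Finset.sum_congr rfl fun j hj => show b (j + 1) = u (j + 1) by
        rw [Finset.mem_range] at hj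
        simp [hb, hj]]
    simp [hb, hR]

end SignedSystems

/-! ### Genuine systems for large `d` -/

section Systems

variable {F V : Type*} [Field F] [AddCommGroup V] [Module F V]

open Classical in
-- Missing members are filled up with the zero space, which lies in every hyperplane and so never
-- counts.
theorem exists_family_of_multiplicity [Finite V] {h : ℕ}
    (e : {U : Submodule F V // finrank F U = h} → ℕ) {n : ℕ} (hn : ∑ U, e U ≤ n) :
    ∃ U : Fin n → Submodule F V, (∀ i, finrank F (U i) ≤ h) ∧
      ∀ f : Dual F V, Nat.card {i // ¬ U i ≤ LinearMap.ker f} =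
        ∑ U with ¬ U.1 ≤ LinearMap.ker f, e U := by
  let g : (Σ U : {U : Submodule F V // finrank F U = h}, Fin (e U)) ⊕ Fin (n - ∑ U, e U) →
      Submodule F V := Sum.elim (fun x => x.1.1) fun _ => ⊥
  have hg (i) : finrank F (g i) ≤ h := by
    rcases i with i | i
    · exact i.1.2.le
    · exact (finrank_bot F V).le.trans (Nat.zero_le h)
  let E : (Σ U : {U : Submodule F V // finrank F U = h}, Fin (e U)) ⊕ Fin (n - ∑ U, e U) ≃ Fin n :=
    Fintype.equivFinOfCardEq (by simp; omega)
  refine ⟨fun i => g (E.symm i), fun i => hg _, fun f => ?_⟩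
  rw [Nat.card_congr (E.symm.subtypeEquiv (q := fun i => ¬ g i ≤ LinearMap.ker f) fun _ => Iff.rfl),
    Nat.card_eq_fintype_card, Fintype.card_subtype, Finset.card_filter, Fintype.sum_sum_type,
    Fintype.sum_sigma, Finset.sum_filter]
  simp only [g, Sum.elim_inl, Sum.elim_inr, bot_le, not_true, if_false, Finset.sum_const_zero,
    add_zero]
  refine Finset.sum_congr rfl fun U _ => ?_
  by_cases hU : U.1 ≤ LinearMap.ker f <;> simp [hU]

/-- Replacing members by the zero subspace one after the other, the minimum number of members
outside a hyperplane takes every intermediate value. -/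
theorem exists_family_exact [Nontrivial (Dual F V)] {ι : Type*} [Fintype ι] {h d : ℕ}
    (U : ι → Submodule F V) (hU : ∀ i, finrank F (U i) ≤ h)
    (hd : ∀ f : Dual F V, f ≠ 0 → d ≤ Nat.card {i // ¬ U i ≤ LinearMap.ker f}) :
    ∃ U' : ι → Submodule F V, (∀ i, finrank F (U' i) ≤ h) ∧
      (∀ f : Dual F V, f ≠ 0 → d ≤ Nat.card {i // ¬ U' i ≤ LinearMap.ker f}) ∧
      ∃ f : Dual F V, f ≠ 0 ∧ Nat.card {i // ¬ U' i ≤ LinearMap.ker f} = d := by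
  classical
  simp only [Nat.card_eq_fintype_card, Fintype.card_subtype] at hd ⊢
  let W (s : Finset ι) (i : ι) : Submodule F V := if i ∈ s then ⊥ else U i
  -- For a maximal set of members that can be zeroed while keeping the bound `d`, zeroing one more
  -- breaks the bound at some `f`; as that costs at most one, the count at `f` was exactly `d`.
  obtain ⟨s, hs, hmax⟩ := (Set.toFinite {s : Finset ι | ∀ f : Dual F V, f ≠ 0 →
    d ≤ (Finset.univ.filter fun i => ¬ W s i ≤ LinearMap.ker f).card}).exists_maximal
      ⟨∅, by simpa [W] using hd⟩
  refine ⟨W s, fun i => ?_, hs, ?_⟩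
  · by_cases hi : i ∈ s
    · rw [show W s i = ⊥ from if_pos hi, finrank_bot]
      exact Nat.zero_le h
    · rw [show W s i = U i from if_neg hi]
      exact hU i
  · by_cases hsu : s = Finset.univ
    · obtain ⟨f, hf⟩ := exists_ne (0 : Dual F V)
      have h1 := hs f hf
      refine ⟨f, hf, le_antisymm ?_ h1⟩
      simp [W, hsu]
    · obtain ⟨i, hi⟩ : ∃ i, i ∉ s := by
        by_contra! h
        exact hsu (Finset.eq_univ_iff_forall.2 h)
      have h1 : ¬ ∀ f : Dual F V, f ≠ 0 →
          d ≤ (Finset.univ.filter fun j => ¬ W (insert i s) j ≤ LinearMap.ker f).card := fun h =>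
        hi (hmax h (Finset.subset_insert i s) (Finset.mem_insert_self i s))
      push Not at h1
      obtain ⟨f, hf, hlt⟩ := h1
      refine ⟨f, hf, le_antisymm ?_ (hs f hf)⟩
      have h2 : (Finset.univ.filter fun j => ¬ W s j ≤ LinearMap.ker f) ⊆
          insert i (Finset.univ.filter fun j => ¬ W (insert i s) j ≤ LinearMap.ker f) := by
        intro j hj
        by_cases hji : j = i
        · simp [hji]
        · simpa [W, hji] using hj
      have h3 := (Finset.card_le_card h2).trans (Finset.card_insert_le _ _)
      omega

variable [Finite F] [Finite V]

theorem exists_family {h m : ℕ} (hh : 1 ≤ h) (hm : 1 ≤ m) (hV : finrank F V = h + m) :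
    ∃ d₀ : ℕ, ∀ d : ℕ, d₀ ≤ d → ∀ n : ℕ,
      griesmerSum (Nat.card F) (h + m) ((Nat.card F : ℤ) ^ (h - 1) * d) ≤
        (qNumber (Nat.card F) h : ℤ) * n →
      ∃ U : Fin n → Submodule F V, (∀ i, finrank F (U i) ≤ h) ∧
        ∀ f : Dual F V, f ≠ 0 → d ≤ Nat.card {i // ¬ U i ≤ LinearMap.ker f} := by
  classical
  have hq0 : 0 < Nat.card F := Nat.card_pos
  obtain ⟨N, hN, hall⟩ := exists_sum_pointIndicator_eq (F := F) (V := V) hh (by omega)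
  have hall' : ∑ U : {U : Submodule F V // finrank F U = h}, (1 : ℤ) • pointIndicator U.1 =
      ∑ _i ∈ (Finset.univ : Finset Unit), (N : ℤ) • pointIndicator (⊤ : Submodule F V) := by
    simpa using hall
  set A : ℤ := ∑ _U : {U : Submodule F V // finrank F U = h}, (1 : ℤ) with hA
  have hcard : (qNumber (Nat.card F) h : ℤ) * A = N * (qNumber (Nat.card F) (h + m) : ℤ) := by
    have := qNumber_mul_sum_eq _ _ _ _ hall'
    simpa only [Finset.univ_unique, Finset.sum_singleton, finrank_top, hV] using this
  have hoff (f : Dual F V) (hf : f ≠ 0) :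
      ∑ U : {U : Submodule F V // finrank F U = h} with ¬ U.1 ≤ LinearMap.ker f, (1 : ℤ) =
        N * (Nat.card F : ℤ) ^ m := by
    have h1 := pow_mul_sum_off_ker_eq _ _ _ _ hall' f
    simp only [Finset.univ_unique, Finset.sum_singleton, finrank_top, hV, top_le_iff,
      LinearMap.ker_eq_top, hf, if_false] at h1
    have h3 : (Nat.card F : ℤ) ^ h ≠ 0 := by positivity
    apply mul_left_cancel₀ h3
    rw [h1, pow_add]
    ring
  have hqh : (0 : ℤ) < qNumber (Nat.card F) h := by exact_mod_cast qNumber_pos hh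
  -- Each residue `ρ` gets a signed solution of least admissible length.
  have hres (ρ : ℕ) : ∃ (n₁ : ℤ) (c : {U : Submodule F V // finrank F U = h} → ℤ),
      (∀ n : ℤ, griesmerSum (Nat.card F) (h + m) ((Nat.card F : ℤ) ^ (h - 1) * ρ) ≤
        (qNumber (Nat.card F) h : ℤ) * n → n₁ ≤ n) ∧ ∑ U, c U = n₁ ∧
      ∀ f : Dual F V, f ≠ 0 → (ρ : ℤ) ≤ ∑ U with ¬ U.1 ≤ LinearMap.ker f, c U := by
    set G := griesmerSum (Nat.card F) (h + m) ((Nat.card F : ℤ) ^ (h - 1) * ρ)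
    obtain ⟨n₁, hn₁, hmin⟩ := Int.exists_least_of_bdd
      (P := fun n => G ≤ (qNumber (Nat.card F) h : ℤ) * n)
      ⟨-|G|, fun z hz => by
        by_contra! hlt
        have h1 := neg_abs_le G
        nlinarith [abs_nonneg G]⟩
      ⟨|G|, by nlinarith [le_abs_self G, abs_nonneg G]⟩
    obtain ⟨c, hc⟩ := exists_signed hh hm hV n₁ ρ hn₁
    exact ⟨n₁, c, hmin, hc⟩
  choose n₁ c hmin hsum hdist using hres
  set D : ℕ := N * Nat.card F ^ m with hD
  have hDpos : 0 < D := by positivity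
  -- `T` bounds all coefficients of the solutions for `ρ < D`, so `T` copies of every `h`-space
  -- cancel any negative one. One copy of all `h`-spaces adds `D` to every count outside a
  -- hyperplane.
  set T : ℕ := ∑ ρ ∈ Finset.range D, ∑ U, (c ρ U).natAbs with hT
  refine ⟨D * T, fun d hd n hn => ?_⟩
  set ρ := d % D with hρ
  set k := d / D with hk
  have hdk : (d : ℤ) = ρ + (k * N : ℤ) * (Nat.card F : ℤ) ^ m := by
    have h1 : d = ρ + D * k := (Nat.mod_add_div d D).symm
    have h2 : (d : ℤ) = ρ + D * k := by exact_mod_cast h1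
    rw [h2, hD]
    push_cast
    ring
  have hTk : T ≤ k := (Nat.le_div_iff_mul_le hDpos).2 (by rwa [mul_comm] at hd)
  have hck (U) : 0 ≤ c ρ U + k := by
    have h1 : (c ρ U).natAbs ≤ ∑ U, (c ρ U).natAbs :=
      Finset.single_le_sum (f := fun U => (c ρ U).natAbs) (fun _ _ => Nat.zero_le _)
        (Finset.mem_univ U)
    have h2 : ∑ U, (c ρ U).natAbs ≤ T :=
      Finset.single_le_sum (f := fun ρ => ∑ U, (c ρ U).natAbs) (fun _ _ => Nat.zero_le _)
        (Finset.mem_range.2 (Nat.mod_lt d hDpos))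
    omega
  have hsumk (s : Finset {U : Submodule F V // finrank F U = h}) :
      ((∑ U ∈ s, (c ρ U + k).toNat : ℕ) : ℤ) = ∑ U ∈ s, c ρ U + k * ∑ U ∈ s, (1 : ℤ) := by
    rw [Nat.cast_sum, Finset.sum_congr rfl fun U _ => Int.toNat_of_nonneg (hck U),
      Finset.sum_add_distrib, Finset.mul_sum]
    simp
  have hle : ∑ U, (c ρ U + k).toNat ≤ n := by
    zify
    rw [← Nat.cast_sum, hsumk, hsum]
    rw [hdk, griesmerSum_add_mul hq0 hh] at hn
    -- The Griesmer sums for `d` and `ρ` differ by `k * N * [h+m] = k * [h] * A`, so `n - k * A` is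
    -- admissible for `ρ`.
    have h1 := hmin ρ (n - k * A) (by linear_combination hn + (k : ℤ) * hcard)
    linarith
  obtain ⟨U, hU, hcount⟩ := exists_family_of_multiplicity (fun U => (c ρ U + k).toNat) hle
  refine ⟨U, hU, fun f hf => ?_⟩
  rw [hcount f]
  zify
  rw [← Nat.cast_sum, hsumk, hoff f hf, hdk]
  have := hdist ρ f hf
  linarith

end Systems

/-! ### The Griesmer bound for linear and additive codes -/

section GriesmerBound

theorem griesmerSum_succ_le (q k : ℕ) (w : ℤ) :
    griesmerSum q (k + 1) w ≤ w + griesmerSum q k ⌈(w : ℚ) / q⌉ := by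
  rw [griesmerSum, Finset.sum_range_succ', add_comm, griesmerSum]
  simp only [pow_zero, div_one, Int.ceil_intCast]
  refine add_le_add le_rfl (Finset.sum_le_sum fun i _ => Int.ceil_le_ceil ?_)
  rw [pow_succ', ← div_div]
  gcongr
  exact Int.le_ceil _

theorem griesmerSum_nonneg {q k : ℕ} {d : ℤ} (hd : 0 ≤ d) : 0 ≤ griesmerSum q k d := by
  refine Finset.sum_nonneg fun i _ => Int.ceil_nonneg ?_
  have : (0 : ℚ) ≤ d := by exact_mod_cast hd
  positivity

open Classical in
theorem card_filter_add_mul_ne_zero {F : Type*} [Field F] [Fintype F] (x y : F) :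
    (Finset.univ.filter fun a : F => x + a * y ≠ 0).card =
      if y = 0 then (if x = 0 then 0 else Fintype.card F) else Fintype.card F - 1 := by
  split_ifs with hy hx
  · simp [hy, hx]
  · simp [hy, hx, Finset.card_univ]
  · have : (Finset.univ.filter fun a : F => x + a * y ≠ 0) = Finset.univ.erase (-x / y) := by
      ext a
      simp only [Finset.mem_filter, Finset.mem_univ, true_and, Finset.mem_erase, and_true, ne_eq,
        eq_div_iff hy, eq_neg_iff_add_eq_zero, add_comm x]
    rw [this, Finset.card_erase_of_mem (Finset.mem_univ _), Finset.card_univ]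

open Classical in
/-- A codeword of minimum weight `w` yields a residual code of minimum distance at least `w / q`. -/
theorem weight_le_card_mul_residual {F V ι : Type*} [Field F] [Fintype F] [AddCommGroup V]
    [Module F V] [Fintype ι] (φ : ι → Dual F V) (v u : V)
    (hmin : ∀ a : F, (Finset.univ.filter fun i => φ i v ≠ 0).card ≤
      (Finset.univ.filter fun i => φ i (u + a • v) ≠ 0).card) :
    (Finset.univ.filter fun i => φ i v ≠ 0).card ≤
      Fintype.card F * (Finset.univ.filter fun i => φ i v = 0 ∧ φ i u ≠ 0).card := by
  set w := (Finset.univ.filter fun i => φ i v ≠ 0).card with hw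
  -- The weights of all `u + a • v` are summed over `a`: a coordinate with `φ i v ≠ 0` contributes
  -- `q - 1`, and one with `φ i v = 0` contributes `q` or `0`.
  have h1 : Fintype.card F * w ≤
      ∑ a : F, (Finset.univ.filter fun i => φ i (u + a • v) ≠ 0).card := by
    have := Finset.card_nsmul_le_sum Finset.univ
      (fun a : F => (Finset.univ.filter fun i => φ i (u + a • v) ≠ 0).card) w fun a _ => hmin a
    simpa [Finset.card_univ] using this
  have h2 : ∑ a : F, (Finset.univ.filter fun i => φ i (u + a • v) ≠ 0).card =
      ∑ i, (Finset.univ.filter fun a : F => φ i u + a * φ i v ≠ 0).card := by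
    simp only [Finset.card_filter, map_add, map_smul, smul_eq_mul]
    exact Finset.sum_comm
  have h3 : ∑ i, (Finset.univ.filter fun a : F => φ i u + a * φ i v ≠ 0).card =
      Fintype.card F * (Finset.univ.filter fun i => φ i v = 0 ∧ φ i u ≠ 0).card +
        (Fintype.card F - 1) * w := by
    rw [hw, Finset.card_filter, Finset.card_filter, Finset.mul_sum, Finset.mul_sum,
      ← Finset.sum_add_distrib]
    refine Finset.sum_congr rfl fun i _ => ?_
    rw [card_filter_add_mul_ne_zero]
    by_cases h1 : φ i v = 0 <;> by_cases h2 : φ i u = 0 <;> simp [h1, h2]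
  rw [h2, h3] at h1
  have h4 : Fintype.card F * w = (Fintype.card F - 1) * w + w := by
    have : 0 < Fintype.card F := Fintype.card_pos
    conv_lhs => rw [← Nat.sub_add_cancel this]
    ring
  omega

open Classical in
/-- The Griesmer bound for linear codes. -/
theorem griesmer_bound {F V ι : Type*} [Field F] [Finite F] [AddCommGroup V] [Module F V]
    [FiniteDimensional F V] [Fintype ι] (φ : ι → Dual F V) (d : ℤ)
    (hd : ∀ v : V, v ≠ 0 → d ≤ (Finset.univ.filter fun i => φ i v ≠ 0).card) :
    griesmerSum (Nat.card F) (finrank F V) d ≤ Fintype.card ι := by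
  have := Fintype.ofFinite F
  obtain ⟨k, hk⟩ : ∃ k, finrank F V = k := ⟨_, rfl⟩
  rw [hk]
  induction k generalizing V ι d with
  | zero => simp [griesmerSum]
  | succ k ih =>
    have : Finite V := Module.finite_of_finite F
    have : Nontrivial V := nontrivial_of_finrank_pos (R := F) (by omega)
    obtain ⟨v, hv, hmin⟩ := Set.exists_min_image {v : V | v ≠ 0}
      (fun v => (Finset.univ.filter fun i => φ i v ≠ 0).card) (Set.toFinite _) (exists_ne (0 : V))
    -- The residual code is the restriction to a complement of the minimum weight word `v`, on the
    -- coordinates where `v` vanishes.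
    obtain ⟨C, hC⟩ := (Submodule.span F {v}).exists_isCompl
    have hCk : finrank F C = k := by
      have := Submodule.finrank_add_eq_of_isCompl hC
      rw [finrank_span_singleton hv] at this
      omega
    have hq : (0 : ℚ) < Nat.card F := by exact_mod_cast Nat.card_pos
    set w := (Finset.univ.filter fun i => φ i v ≠ 0).card with hw
    have hrec := ih (fun i : {i // φ i v = 0} => (φ i.1).domRestrict C) ⌈((w : ℤ) : ℚ) / Nat.card F⌉
      (fun u hu => by
        rw [Int.ceil_le, div_le_iff₀ hq]
        have h1 := weight_le_card_mul_residual φ v u fun a => hmin (u + a • v) fun h0 => hu <| by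
          have h2 : (u : V) ∈ Submodule.span F {v} := by
            rw [eq_neg_of_add_eq_zero_left h0]
            exact neg_mem (Submodule.smul_mem _ a (Submodule.mem_span_singleton_self v))
          exact Subtype.ext (Submodule.disjoint_def.1 hC.disjoint _ h2 u.2)
        have h3 : (Finset.univ.filter fun i => φ i v = 0 ∧ φ i u ≠ 0).card =
            (Finset.univ.filter fun i : {i // φ i v = 0} =>
              (φ i.1).domRestrict C u ≠ 0).card := by
          rw [← Fintype.card_subtype, ← Fintype.card_subtype]
          exact (Fintype.card_congr (Equiv.subtypeSubtypeEquivSubtypeInter _ _)).symm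
        rw [h3, ← Nat.card_eq_fintype_card (α := F)] at h1
        rw [mul_comm]
        exact_mod_cast h1) hCk
    have hcard : Fintype.card {i // φ i v = 0} + w = Fintype.card ι := by
      rw [Fintype.card_subtype, hw]
      exact Finset.card_filter_add_card_filter_not _
    calc griesmerSum (Nat.card F) (k + 1) d ≤ griesmerSum (Nat.card F) (k + 1) w :=
          griesmerSum_mono (hd v hv)
      _ ≤ w + griesmerSum (Nat.card F) k ⌈((w : ℤ) : ℚ) / Nat.card F⌉ := griesmerSum_succ_le _ _ _
      _ ≤ w + Fintype.card {i // φ i v = 0} := by gcongr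
      _ = Fintype.card ι := by rw [← hcard]; push_cast; ring

open Classical in
theorem card_functionals_ne_zero {F E : Type*} [Field F] [Finite F] [AddCommGroup E] [Module F E]
    [Finite E] {e : E} (he : e ≠ 0) :
    (Finset.univ.filter fun p : ℙ F (Dual F E) => p.rep e ≠ 0).card =
      Nat.card F ^ (finrank F E - 1) := by
  have h1 := card_hyperplanes_ge (F := F) (⊥ : Submodule F E)
  have h2 := card_hyperplanes_ge (F := F) (Submodule.span F {e})
  rw [finrank_span_singleton he] at h2
  simp only [bot_le, finrank_bot, Nat.sub_zero, Submodule.span_singleton_le_iff_mem,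
    LinearMap.mem_ker] at h1 h2
  rw [Nat.card_eq_fintype_card, Fintype.card_subtype, Finset.filter_true] at h1
  rw [Nat.card_eq_fintype_card, Fintype.card_subtype] at h2
  have h3 := Finset.card_filter_add_card_filter_not (s := Finset.univ)
    (fun p : ℙ F (Dual F E) => p.rep e = 0)
  have : Nontrivial E := ⟨e, 0, he⟩
  have h4 : 0 < finrank F E := finrank_pos
  rw [h1, h2] at h3
  have h5 := qNumber_succ (Nat.card F) (finrank F E - 1)
  rw [Nat.sub_add_cancel h4] at h5
  exact Nat.add_left_cancel (h3.trans h5)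

open Classical in
/-- The Griesmer bound for additive codes. -/
theorem griesmer_bound_additive {F V E ι : Type*} [Field F] [Finite F] [AddCommGroup V]
    [Module F V] [FiniteDimensional F V] [AddCommGroup E] [Module F E] [FiniteDimensional F E]
    [Fintype ι] (φ : ι → V →ₗ[F] E) (d : ℕ)
    (hd : ∀ v : V, v ≠ 0 → d ≤ (Finset.univ.filter fun i => φ i v ≠ 0).card) :
    griesmerSum (Nat.card F) (finrank F V) ((Nat.card F : ℤ) ^ (finrank F E - 1) * d) ≤
      (qNumber (Nat.card F) (finrank F E) : ℤ) * Fintype.card ι := by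
  have : Finite E := Module.finite_of_finite F
  -- Concatenation with the simplex code: a nonzero symbol is nonzero at exactly `q^(h-1)`
  -- functionals up to scalars, where `h = dim E`.
  have h1 := griesmer_bound (fun x : ι × ℙ F (Dual F E) => x.2.rep ∘ₗ φ x.1)
    ((Nat.card F : ℤ) ^ (finrank F E - 1) * d) (fun v hv => by
      have h2 : (Finset.univ.filter fun x : ι × ℙ F (Dual F E) =>
          (x.2.rep ∘ₗ φ x.1) v ≠ 0).card =
            Nat.card F ^ (finrank F E - 1) * (Finset.univ.filter fun i => φ i v ≠ 0).card := by
        rw [Finset.card_filter, Fintype.sum_prod_type, Finset.card_filter, Finset.mul_sum]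
        refine Finset.sum_congr rfl fun i _ => ?_
        rw [← Finset.card_filter]
        by_cases h0 : φ i v = 0
        · simp [h0]
        · simp only [LinearMap.comp_apply, card_functionals_ne_zero h0, ne_eq, h0,
            not_false_eq_true, if_true, mul_one]
      rw [h2]
      push_cast
      have := hd v hv
      gcongr)
  rw [Fintype.card_prod] at h1
  have h2 : Fintype.card (ℙ F (Dual F E)) = qNumber (Nat.card F) (finrank F E) := by
    rw [← Nat.card_eq_fintype_card, Projectivization.card_of_finrank F (Dual F E)
      (Subspace.dual_finrank_eq), qNumber]
  rw [h2, mul_comm (Fintype.card ι)] at h1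
  exact_mod_cast h1

end GriesmerBound

/-! ### Dictionary between systems and additive codes -/

section Translation

theorem exists_injective_of_finrank_le {F V W : Type*} [Field F] [AddCommGroup V] [Module F V]
    [AddCommGroup W] [Module F W] [FiniteDimensional F V] [FiniteDimensional F W]
    (h : finrank F V ≤ finrank F W) : ∃ f : V →ₗ[F] W, Function.Injective f := by
  obtain ⟨S, -, hS⟩ := exists_submodule_ge_finrank_eq (⊥ : Submodule F W) (by simp) h
  exact ⟨S.subtype ∘ₗ (LinearEquiv.ofFinrankEq V S hS.symm).toLinearMap,
    S.injective_subtype.comp (LinearEquiv.injective _)⟩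

/-- A family of subspaces of dimension at most `dim E` gives rise to coordinate maps into `E`. -/
theorem exists_coordinates {F V E ι : Type*} [Field F] [AddCommGroup V] [Module F V]
    [AddCommGroup E] [Module F E] [FiniteDimensional F V] [FiniteDimensional F E]
    (U : ι → Submodule F V) (hU : ∀ i, finrank F (U i) ≤ finrank F E) :
    ∃ φ : ι → Dual F V →ₗ[F] E, ∀ i f, φ i f = 0 ↔ U i ≤ LinearMap.ker f := by
  have h1 (i : ι) : ∃ g : Dual F (U i) →ₗ[F] E, Function.Injective g :=
    exists_injective_of_finrank_le (by rw [Subspace.dual_finrank_eq]; exact hU i)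
  choose g hg using h1
  -- The coordinate of `f` is its restriction to `U i`, embedded into `E`.
  refine ⟨fun i => g i ∘ₗ Dual.transpose (U i).subtype, fun i f => ?_⟩
  rw [LinearMap.comp_apply, map_eq_zero_iff _ (hg i), LinearMap.ext_iff]
  exact ⟨fun h x hx => h ⟨x, hx⟩, fun h x => h x.2⟩

theorem exists_eq_ker_of_finrank_add_one {F V : Type*} [Field F] [AddCommGroup V] [Module F V]
    [FiniteDimensional F V] {H : Submodule F V} (hH : finrank F H + 1 = finrank F V) :
    ∃ f : Dual F V, f ≠ 0 ∧ H = LinearMap.ker f := by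
  have hlt : H < ⊤ := lt_top_iff_ne_top.2 fun h => by
    rw [h, finrank_top] at hH
    omega
  obtain ⟨f, hf, hle⟩ := Submodule.exists_le_ker_of_lt_top H hlt
  refine ⟨f, hf, Submodule.eq_of_le_of_finrank_eq hle ?_⟩
  have := Dual.finrank_ker_add_one_of_ne_zero hf
  omega

theorem Multiset.exists_eq_map_univ {α : Type*} {S : Multiset α} {n : ℕ} (hS : S.card = n) :
    ∃ U : Fin n → α, S = (Finset.univ : Finset (Fin n)).val.map U := by
  obtain ⟨l, rfl⟩ : ∃ l : List α, (l : Multiset α) = S := ⟨S.toList, S.coe_toList⟩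
  rw [Multiset.coe_card] at hS
  subst hS
  exact ⟨l.get, by rw [Fin.univ_val_map, List.ofFn_get]⟩

open Classical in
theorem card_not_le_add {F V : Type*} [Field F] [AddCommGroup V] [Module F V] {n : ℕ}
    (U : Fin n → Submodule F V) (H : Submodule F V) :
    Nat.card {i // ¬ U i ≤ H} +
      ((Finset.univ : Finset (Fin n)).val.map U).countP (fun W => W ≤ H) = n := by
  rw [Multiset.countP_map, Nat.card_eq_fintype_card, Fintype.card_subtype, add_comm]
  conv_rhs => rw [← Fintype.card_fin n, ← Finset.card_univ,
    ← Finset.card_filter_add_card_filter_not (s := Finset.univ) (fun i => U i ≤ H)]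
  rfl

theorem griesmer_bound_family {F V : Type*} [Field F] [Finite F] [AddCommGroup V] [Module F V]
    [FiniteDimensional F V] {h n d : ℕ} (U : Fin n → Submodule F V)
    (hU : ∀ i, finrank F (U i) ≤ h)
    (hd : ∀ f : Dual F V, f ≠ 0 → d ≤ Nat.card {i // ¬ U i ≤ LinearMap.ker f}) :
    griesmerSum (Nat.card F) (finrank F V) ((Nat.card F : ℤ) ^ (h - 1) * d) ≤
      (qNumber (Nat.card F) h : ℤ) * n := by
  classical
  obtain ⟨φ, hφ⟩ := exists_coordinates (E := Fin h → F) U (by simpa using hU)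
  have h1 := griesmer_bound_additive φ d fun f hf => by
    have := hd f hf
    rw [Nat.card_eq_fintype_card, Fintype.card_subtype] at this
    simpa only [ne_eq, hφ] using this
  simpa [Subspace.dual_finrank_eq] using h1

theorem isProjectiveSystem_of_family {F : Type*} [Field F] {h n r s d : ℕ} (hn : n = s + d)
    (U : Fin n → Submodule F (Fin r → F)) (hU : ∀ i, finrank F (U i) ≤ h)
    (hd : ∀ f : Dual F (Fin r → F), f ≠ 0 → d ≤ Nat.card {i // ¬ U i ≤ LinearMap.ker f})
    (hex : ∃ f : Dual F (Fin r → F), f ≠ 0 ∧ Nat.card {i // ¬ U i ≤ LinearMap.ker f} = d) :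
    IsProjectiveSystem F h n r s ((Finset.univ : Finset (Fin n)).val.map U) where
  card_eq := by simp
  finrank_le W hW := by
    obtain ⟨i, -, rfl⟩ := Multiset.mem_map.1 hW
    exact hU i
  count_le H hH := by
    obtain ⟨f, hf, rfl⟩ := exists_eq_ker_of_finrank_add_one (H := H) (by simpa using hH)
    have h1 := card_not_le_add U (LinearMap.ker f)
    have h2 := hd f hf
    omega
  exists_count_eq := by
    obtain ⟨f, hf, hfd⟩ := hex
    refine ⟨LinearMap.ker f, by simpa using Dual.finrank_ker_add_one_of_ne_zero hf, ?_⟩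
    have h1 := card_not_le_add U (LinearMap.ker f)
    omega

theorem IsProjectiveSystem.griesmerSum_le {F : Type*} [Field F] [Finite F] {h n r s : ℕ}
    {S : Multiset (Submodule F (Fin r → F))} (hS : IsProjectiveSystem F h n r s S) (hsn : s ≤ n) :
    griesmerSum (Nat.card F) r ((Nat.card F : ℤ) ^ (h - 1) * ((n : ℤ) - s)) ≤
      (qNumber (Nat.card F) h : ℤ) * n := by
  obtain ⟨U, rfl⟩ := Multiset.exists_eq_map_univ hS.card_eq
  have h1 := griesmer_bound_family (d := n - s) U
    (fun i => hS.finrank_le _ (Multiset.mem_map_of_mem U (Finset.mem_univ_val i))) fun f hf => by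
      have h2 := card_not_le_add U (LinearMap.ker f)
      have h3 := hS.count_le (LinearMap.ker f)
        (by simpa using Dual.finrank_ker_add_one_of_ne_zero hf)
      omega
  rwa [Nat.cast_sub hsn, finrank_fin_fun] at h1

theorem IsAdditiveCode.griesmerSum_le {F K : Type*} [Field F] [Finite F] [Field K] [Algebra F K]
    [FiniteDimensional F K] {n r d : ℕ} {C : Submodule F (Fin n → K)}
    (hC : IsAdditiveCode F K n r d C) :
    griesmerSum (Nat.card F) r ((Nat.card F : ℤ) ^ (finrank F K - 1) * d) ≤
      (qNumber (Nat.card F) (finrank F K) : ℤ) * n := by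
  classical
  have h1 := griesmer_bound_additive (fun i : Fin n => LinearMap.proj i ∘ₗ C.subtype) d
    fun v hv => by
      have h2 := hC.minDist_eq.2 ⟨v, v.2, 0, C.zero_mem, fun h => hv (Subtype.ext h), rfl⟩
      rw [hammingDist_zero_right, hammingNorm] at h2
      convert h2
      rfl
  rwa [hC.finrank_eq, Fintype.card_fin] at h1

theorem exists_isAdditiveCode_of_family {F K : Type*} [Field F] [Finite F] [Field K] [Algebra F K]
    [FiniteDimensional F K] {n r d : ℕ} (hd0 : 1 ≤ d) (U : Fin n → Submodule F (Fin r → F))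
    (hU : ∀ i, finrank F (U i) ≤ finrank F K)
    (hd : ∀ f : Dual F (Fin r → F), f ≠ 0 → d ≤ Nat.card {i // ¬ U i ≤ LinearMap.ker f})
    (hex : ∃ f : Dual F (Fin r → F), f ≠ 0 ∧ Nat.card {i // ¬ U i ≤ LinearMap.ker f} = d) :
    ∃ C : Submodule F (Fin n → K), IsAdditiveCode F K n r d C := by
  classical
  obtain ⟨φ, hφ⟩ := exists_coordinates (E := K) U hU
  have hdist (f g : Dual F (Fin r → F)) : hammingDist (LinearMap.pi φ f) (LinearMap.pi φ g) =
      Nat.card {i // ¬ U i ≤ LinearMap.ker (f - g)} := by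
    rw [hammingDist, Nat.card_eq_fintype_card, Fintype.card_subtype]
    congr 1
    ext i
    rw [Finset.mem_filter, Finset.mem_filter, ← hφ, map_sub, sub_eq_zero]
    rfl
  have hinj : Function.Injective (LinearMap.pi φ) := fun f g hfg => by
    by_contra hne
    have h1 := hd (f - g) (sub_ne_zero.2 hne)
    rw [← hdist, hfg, hammingDist_self] at h1
    omega
  refine ⟨LinearMap.range (LinearMap.pi φ), ?_, ?_, ?_⟩
  · rw [LinearMap.finrank_range_of_inj hinj, Subspace.dual_finrank_eq, finrank_fin_fun]
  · obtain ⟨f, hf, hfd⟩ := hex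
    refine ⟨_, ⟨f, rfl⟩, _, ⟨0, rfl⟩, fun h => hf (hinj h), ?_⟩
    have h1 := hdist f 0
    rw [sub_zero, hfd] at h1
    convert h1
  · rintro w ⟨_, ⟨f, rfl⟩, _, ⟨g, rfl⟩, hne, rfl⟩
    have h1 := hd (f - g) (sub_ne_zero.2 fun h => hne (by rw [h]))
    rw [← hdist] at h1
    convert h1

end Translation

/-! ### The main theorem -/

theorem le_of_griesmerSum_le {q h m s : ℕ} (hq : 0 < q) (hh : 1 ≤ h) (hm : 1 ≤ m) {x : ℤ}
    (hx : griesmerSum q (h + m) ((q : ℤ) ^ (h - 1) * x) ≤ (qNumber q h : ℤ) * (x + s)) :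
    x ≤ q * (qNumber q h * s) := by
  rcases le_or_gt x 0 with h0 | h0
  · exact h0.trans (by positivity)
  -- After cancelling `[h]_q x`, the single term `⌈x/q⌉`, present because `m ≥ 1`, is at most `[h]_q
  -- s`.
  rw [griesmerSum_eq hq hh, mul_add, add_le_add_iff_left] at hx
  have hx' : (0 : ℚ) < x := by exact_mod_cast h0
  have h1 := Finset.single_le_sum (f := fun j : ℕ => ⌈(x : ℚ) / (q : ℚ) ^ (j + 1)⌉)
    (fun j _ => Int.ceil_nonneg (by positivity)) (Finset.mem_range.2 hm)
  have h2 := Int.ceil_le.1 (h1.trans hx)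
  have hq' : (0 : ℚ) < q := by exact_mod_cast hq
  rw [zero_add, pow_one, div_le_iff₀ hq', mul_comm] at h2
  exact_mod_cast h2

theorem mainTheorem1 {F : Type*} [Field F] [Finite F] (r h : ℕ) (hh : 1 ≤ h) (hr : h < r) :
    (∃ s₀ : ℕ, ∀ s : ℕ, s₀ ≤ s →
      ∃ n : ℕ, IsMaxSystemSize F r h s n ∧ IsGriesmerUpperBound (Nat.card F) r h s (n : ℤ)) ∧
    (∃ d₀ : ℕ, ∀ d : ℕ, d₀ ≤ d →
      ∀ (K : Type*) [Field K] [Algebra F K], Module.finrank F K = h →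
        ∃ n : ℕ, IsMinCodeLength F K r d n ∧
          IsGriesmerLengthBound (Nat.card F) r h d (n : ℤ)) := by
  obtain ⟨m, rfl⟩ := Nat.exists_eq_add_of_lt hr
  rw [add_assoc] at *
  have hq : 0 < Nat.card F := Nat.card_pos
  have hqh : (1 : ℤ) ≤ qNumber (Nat.card F) h := by exact_mod_cast qNumber_pos hh
  have hdual : Nontrivial (Dual F (Fin (h + (m + 1)) → F)) :=
    nontrivial_of_finrank_pos (R := F) (by rw [Subspace.dual_finrank_eq, finrank_fin_fun]; omega)
  obtain ⟨d₀, hd₀⟩ := exists_family (F := F) (V := Fin (h + (m + 1)) → F) hh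
    (Nat.le_add_left 1 m) (finrank_fin_fun F)
  constructor
  · set G := griesmerSum (Nat.card F) (h + (m + 1)) ((Nat.card F : ℤ) ^ (h - 1) * d₀) with hG
    -- For `s ≥ G` the length `d₀ + s` is admissible, so the greatest admissible `n` has `n - s ≥
    -- d₀`.
    refine ⟨G.toNat, fun s hs => ?_⟩
    obtain ⟨n, hn, hmax⟩ := Int.exists_greatest_of_bdd
      (P := fun n : ℤ => griesmerSum (Nat.card F) (h + (m + 1))
        ((Nat.card F : ℤ) ^ (h - 1) * (n - s)) ≤ (qNumber (Nat.card F) h : ℤ) * n)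
      ⟨Nat.card F * (qNumber (Nat.card F) h * s) + s, fun z hz => by
        have := le_of_griesmerSum_le (s := s) (x := z - s) hq hh (Nat.le_add_left 1 m)
          (by simpa using hz)
        linarith⟩
      ⟨d₀ + s, by
        rw [add_sub_cancel_right, ← hG]
        have : G ≤ s := by omega
        nlinarith⟩
    have hns : (d₀ : ℤ) + s ≤ n := hmax _ (by
        rw [add_sub_cancel_right, ← hG]
        have : G ≤ s := by omega
        nlinarith)
    obtain ⟨d, rfl⟩ : ∃ d : ℕ, n = (s + d : ℕ) := ⟨(n - s).toNat, by omega⟩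
    refine ⟨s + d, ⟨?_, ?_⟩, hn, hmax⟩
    · obtain ⟨U, hU, hUd⟩ := hd₀ d (by omega) (s + d) (by simpa using hn)
      obtain ⟨U', hU', hUd', hex⟩ := exists_family_exact U hU hUd
      exact ⟨_, isProjectiveSystem_of_family rfl U' hU' hUd' hex⟩
    · rintro n' ⟨S, hS⟩
      rcases le_or_gt n' s with hle | hlt
      · omega
      · exact_mod_cast hmax _ (hS.griesmerSum_le hlt.le)
  · refine ⟨max d₀ 1, fun d hd K _ _ hK => ?_⟩
    have : FiniteDimensional F K := Module.finite_of_finrank_pos (by omega)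
    set G := griesmerSum (Nat.card F) (h + (m + 1)) ((Nat.card F : ℤ) ^ (h - 1) * d) with hG
    have hG0 : 0 ≤ G := griesmerSum_nonneg (by positivity)
    obtain ⟨n, hn, hmin⟩ := Int.exists_least_of_bdd
      (P := fun n : ℤ => G ≤ (qNumber (Nat.card F) h : ℤ) * n)
      ⟨0, fun z hz => nonneg_of_mul_nonneg_right (hG0.trans hz) (by omega)⟩ ⟨G, by nlinarith⟩
    obtain ⟨n, rfl⟩ : ∃ k : ℕ, n = k :=
      ⟨n.toNat, (Int.toNat_of_nonneg (nonneg_of_mul_nonneg_right (hG0.trans hn) (by omega))).symm⟩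
    refine ⟨n, ⟨?_, ?_⟩, hn, hmin⟩
    · obtain ⟨U, hU, hUd⟩ := hd₀ d (by omega) n hn
      obtain ⟨U', hU', hUd', hex⟩ := exists_family_exact U hU hUd
      exact exists_isAdditiveCode_of_family (by omega) U' (by rwa [hK]) hUd' hex
    · rintro n' ⟨C, hC⟩
      have h1 := hC.griesmerSum_le
      rw [hK] at h1
      exact_mod_cast hmin _ h1
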